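/- **Setting.** Let $1\le M'\le N$. There are $N$ secondary users (SUs) and $M'$ idle channels; the random bid $a_{ij,k}\in\mathbb R$ is the worth to SU $i$ of channel $j$ while channel $k$ is jammed. An *allocation* $h$ is an injective map from the channels to the SUs; its *elements* are the pairs $(h(j),j)$, and its vector is $\boldsymbol h=\big(\sum_{j} a_{h(j)j,k}\big)_{k=1}^{M'}\in\mathbb R^{M'}$. *Original game.* The coordinator chooses an allocation $h$, the jammer a channel $k$, and the jammer pays the coordinator $\boldsymbol h_k$; the payoff matrix $\boldsymbol U$ has $\frac{N!}{(N-M')!}$ rows and $M'$ columns. *PC-game.* Let $\boldsymbol p_2^*$ be an optimal (minimax) mixed strategy of the jammer in the original game and let $a'_{ij}=\sum_k p^*_{2,k}\,a_{ij,k}$. The coordinator chooses a profile $(l_1,\dots,l_N)\in\{1,\dots,M'\}^N$ of first preferences. In the first auction SU $i$ bids $a'_{il_i}$, for channel $l_i$ only, and the channels that receive a bid are allocated so as to maximize the sum of the accepted bids; in the second auction the remaining channels are allocated to the remaining SUs, at most one to each, so as to maximize the sum of the accepted bids $a'_{ij}$. Ties in either auction are broken by an arbitrary, possibly random, rule. The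 jammer chooses a channel $k$ and pays the coordinator the (expected) $k$-th entry of the vector of the resulting allocation; this payoff matrix has $M'^N$ rows and $M'$ columns. **Assumption (generic bids).** For all allocations $h_1,\dots,h_{M'},h_{M'+1}$ such that each of $h_1,\dots,h_{M'}$ has an element that is not an element of any other of the $M'+1$ allocations, the probability that there are real numbers $\lambda_1,\dots,\lambda_{M'}$ with $$\sum_{i=1}^{M'}\lambda_i\boldsymbol h_i=\boldsymbol h_{M'+1},\qquad \sum_{i=1}^{M'}\lambda_i=1$$ is zero. **Proposition 2.** Under this assumption, with probability one, for every optimal strategy $\boldsymbol p_2^*$ of the jammer and every tie-breaking rule, the PC-game and the original game both have a value in mixed strategies ($\max_{\boldsymbol p_1}\min_{\boldsymbol p_2}=\min_{\boldsymbol p_2}\max_{\boldsymbol p_1}$), and the two values are equal. -/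

import Mathlib

namespace AntiJamming

/-! ### Finite zero-sum games -/

/-- The expected payoff `pᵀ U q` of the row player (maximizer). -/
def payoff {R C : Type} [Fintype R] [Fintype C] (U : Matrix R C ℝ) (p : R → ℝ) (q : C → ℝ) : ℝ :=
  ∑ r, ∑ c, p r * U r c * q c

/-- `v` is the value of the game `U`, that is
`max_p min_q pᵀ U q = min_q max_p pᵀ U q = v` over mixed strategies: the row player has a mixed
strategy securing at least `v`, the column player has one conceding at most `v`. -/
def IsGameValue {R C : Type} [Fintype R] [Fintype C] (U : Matrix R C ℝ) (v : ℝ) : Prop :=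
  (∃ p ∈ stdSimplex ℝ R, ∀ q ∈ stdSimplex ℝ C, v ≤ payoff U p q) ∧
    (∃ q ∈ stdSimplex ℝ C, ∀ p ∈ stdSimplex ℝ R, payoff U p q ≤ v)

/-- `q` is an optimal (minimax) mixed strategy of the column player:
it attains `min_q max_p pᵀ U q`. -/
def IsMinimaxStrategy {R C : Type} [Fintype R] [Fintype C] (U : Matrix R C ℝ) (q : C → ℝ) : Prop :=
  q ∈ stdSimplex ℝ C ∧ ∀ q' ∈ stdSimplex ℝ C,
    (⨆ p : stdSimplex ℝ R, payoff U p q) ≤ ⨆ p : stdSimplex ℝ R, payoff U p q'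

/-! ### Allocations of the idle channels

There are `N` secondary users and `M` idle channels. The bid `a i j k` is the worth to user `i`
of channel `j` while channel `k` is jammed. -/

/-- An allocation gives every idle channel to exactly one user and at most one channel to every
user: it is an injective map from channels to users. -/
abbrev Allocation (N M : ℕ) : Type := Fin M ↪ Fin N

/-- The elements of an allocation: its pairs (user, channel). -/
def elements {N M : ℕ} (h : Allocation N M) : Finset (Fin N × Fin M) :=
  Finset.univ.image fun j => (h j, j)

/-- The vector of an allocation: its total worth, for each choice of the jammed channel. -/
def allocVec {N M : ℕ} (a : Fin N → Fin M → Fin M → ℝ) (h : Allocation N M) : Fin M → ℝ :=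
  fun k => ∑ j, a (h j) j k

/-- The payoff matrix of the original game: the coordinator chooses an allocation, the jammer
chooses an idle channel. -/
def originalGame {N M : ℕ} (a : Fin N → Fin M → Fin M → ℝ) : Matrix (Allocation N M) (Fin M) ℝ :=
  Matrix.of fun h k => allocVec a h k

/-! ### The two-level auction -/

/-- The expected bids when the jammer plays the mixed strategy `q`. -/
def expectedBid {N M : ℕ} (a : Fin N → Fin M → Fin M → ℝ) (q : Fin M → ℝ) (e : Fin N × Fin M) : ℝ :=
  ∑ k, q k * a e.1 e.2 k

/-- `z` (the set of the pairs with `z_{ij} = 1`) assigns each channel of `C` to exactly one user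
and no other channel, gives at most one channel to each user, and uses only pairs from `E`. -/
def IsAssignment {N M : ℕ} (E : Finset (Fin N × Fin M)) (C : Finset (Fin M))
    (z : Finset (Fin N × Fin M)) : Prop :=
  z ⊆ E ∧ (∀ e ∈ z, e.2 ∈ C) ∧ (∀ j ∈ C, ∃! i, (i, j) ∈ z) ∧
    ∀ i j j', (i, j) ∈ z → (i, j') ∈ z → j = j'

/-- `z` solves the auction of the channels `C` with admissible pairs `E` and bids `w`: it is an
assignment that maximizes the sum of the accepted bids. -/
def IsAuctionSolution {N M : ℕ} (w : Fin N × Fin M → ℝ) (E : Finset (Fin N × Fin M))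
    (C : Finset (Fin M)) (z : Finset (Fin N × Fin M)) : Prop :=
  IsAssignment E C z ∧ ∀ z', IsAssignment E C z' → ∑ e ∈ z', w e ≤ ∑ e ∈ z, w e

/-- `h` is a possible outcome of the two-level auction with first preferences `l`. In the first
auction every user bids only for its first preference, and the channels on which there is a bid are
sold; in the second auction the remaining channels are sold to the remaining users. -/
def IsOutcome {N M : ℕ} (w : Fin N × Fin M → ℝ) (l : Fin N → Fin M) (h : Allocation N M) : Prop :=
  ∃ z₁ z₂ : Finset (Fin N × Fin M),
    IsAuctionSolution w (Finset.univ.image fun i => (i, l i)) (Finset.univ.image l) z₁ ∧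
    IsAuctionSolution w ((z₁.image Prod.fst)ᶜ ×ˢ (z₁.image Prod.snd)ᶜ) (z₁.image Prod.snd)ᶜ z₂ ∧
    elements h = z₁ ∪ z₂

/-- A random tie-breaking rule: to every profile `l` of first preferences it assigns a probability
distribution carried by the possible outcomes of the two-level auction. -/
def IsTieBreaking {N M : ℕ} (w : Fin N × Fin M → ℝ)
    (τ : (Fin N → Fin M) → Allocation N M → ℝ) : Prop :=
  ∀ l, τ l ∈ stdSimplex ℝ (Allocation N M) ∧ ∀ h, τ l h ≠ 0 → IsOutcome w l h

/-- The payoff matrix of the two-level auction game: the coordinator chooses the profile of first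
preferences, the jammer chooses an idle channel, and the payoff is the expected worth of the
allocation that results. -/
noncomputable def pcGame {N M : ℕ} (a : Fin N → Fin M → Fin M → ℝ)
    (τ : (Fin N → Fin M) → Allocation N M → ℝ) : Matrix (Fin N → Fin M) (Fin M) ℝ :=
  Matrix.of fun l k => ∑ h, τ l h * allocVec a h k

/-! ### Generic bids -/

/-- Each of the allocations `h 0, …, h (M-1)` has an element that occurs neither in `h₀` nor in
another `h i'`. -/
def HavePrivateElements {N M : ℕ} (h₀ : Allocation N M) (h : Fin M → Allocation N M) : Prop :=
  ∀ i, ∃ e ∈ elements (h i), e ∉ elements h₀ ∧ ∀ i', i' ≠ i → e ∉ elements (h i')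

/-- The vector of `h₀` is an affine combination of the vectors of `h 0, …, h (M-1)`. -/
def AffinelyRelated {N M : ℕ} (a : Fin N → Fin M → Fin M → ℝ) (h₀ : Allocation N M)
    (h : Fin M → Allocation N M) : Prop :=
  ∃ c : Fin M → ℝ, ∑ i, c i = 1 ∧ ∑ i, c i • allocVec a (h i) = allocVec a h₀

end AntiJamming

namespace AntiJamming

open Finset

/-! ### Finite zero-sum games -/

section Games

variable {R C : Type} [Fintype R] [Fintype C] (U : Matrix R C ℝ)

/-! Let `q` be the jammer's minimax strategy and `v` the value of the original game. By the minimax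
theorem some mixed strategy `p` of the coordinator forms a saddle point with `q`, and by
complementary slackness (`row_eq_of_optimal`) every allocation in the support of `p` maximizes the
expected bids.

Each such allocation can be forced as the only auction outcome (`exists_profile_of_maximal`): owners
name their own channel, and each idle user names one on which it is strictly outbid. An idle user
without such a channel would, by maximality, tie with every owner, and singularity of a square
matrix would then yield a forbidden affine relation (`exists_affinelyRelated_of_ties`).

Carrying `p` over to the forcing profiles secures `v` in the PC-game. Conversely, every row of that
game is a convex combination of original rows, so `q` still concedes at most `v`. -/

theorem payoff_eq_sum_rows (p : R → ℝ) (q : C → ℝ) :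
    payoff U p q = ∑ r, p r * ∑ c, U r c * q c := by
  simp only [payoff, mul_sum, mul_assoc]

theorem payoff_eq_sum_columns (p : R → ℝ) (q : C → ℝ) :
    payoff U p q = ∑ c, (∑ r, p r * U r c) * q c := by
  simp only [payoff, sum_mul]
  exact sum_comm

theorem payoff_add_left (p p' : R → ℝ) (q : C → ℝ) :
    payoff U (p + p') q = payoff U p q + payoff U p' q := by
  simp [payoff, add_mul, sum_add_distrib]

theorem payoff_smul_left (t : ℝ) (p : R → ℝ) (q : C → ℝ) :
    payoff U (t • p) q = t * payoff U p q := by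
  simp [payoff, mul_sum, mul_assoc]

theorem payoff_add_right (p : R → ℝ) (q q' : C → ℝ) :
    payoff U p (q + q') = payoff U p q + payoff U p q' := by
  simp [payoff, mul_add, sum_add_distrib]

theorem payoff_smul_right (t : ℝ) (p : R → ℝ) (q : C → ℝ) :
    payoff U p (t • q) = t * payoff U p q := by
  simp [payoff, mul_sum, mul_left_comm]

theorem payoff_single_left [DecidableEq R] (r : R) (q : C → ℝ) :
    payoff U (Pi.single r 1) q = ∑ c, U r c * q c := by
  simp [payoff_eq_sum_rows, Pi.single_apply]

theorem continuous_payoff_left (q : C → ℝ) : Continuous fun p => payoff U p q := by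
  unfold payoff
  fun_prop

theorem continuous_payoff_right (p : R → ℝ) : Continuous fun q => payoff U p q := by
  unfold payoff
  fun_prop

/-- Sion's theorem applies because the payoff is bilinear and continuous and the simplices are
compact and convex. The minimizer's variable comes first. -/
theorem exists_isSaddlePointOn_payoff [Nonempty R] [Nonempty C] :
    ∃ q ∈ stdSimplex ℝ C, ∃ p ∈ stdSimplex ℝ R,
      IsSaddlePointOn (stdSimplex ℝ C) (stdSimplex ℝ R) (fun q p => payoff U p q) q p := by
  classical
  have hR : (stdSimplex ℝ R).Nonempty := ⟨_, single_mem_stdSimplex ℝ (Classical.arbitrary R)⟩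
  have hC : (stdSimplex ℝ C).Nonempty := ⟨_, single_mem_stdSimplex ℝ (Classical.arbitrary C)⟩
  refine Sion.exists_isSaddlePointOn hC (convex_stdSimplex ℝ C) (isCompact_stdSimplex ℝ C)
    (fun p _ => (continuous_payoff_right U p).lowerSemicontinuous.lowerSemicontinuousOn _)
    (fun p _ => ConvexOn.quasiconvexOn ⟨convex_stdSimplex ℝ C, fun q _ q' _ s t _ _ _ => ?_⟩)
    (convex_stdSimplex ℝ R) hR (isCompact_stdSimplex ℝ R)
    (fun q _ => (continuous_payoff_left U q).upperSemicontinuous.upperSemicontinuousOn _)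
    (fun q _ => ConcaveOn.quasiconcaveOn ⟨convex_stdSimplex ℝ R, fun p _ p' _ s t _ _ _ => ?_⟩)
  · simp [payoff_add_right, payoff_smul_right]
  · simp [payoff_add_left, payoff_smul_left]

variable {U}

/-- A minimax strategy of the column player is one half of a saddle point. -/
theorem IsMinimaxStrategy.exists_optimal_row_strategy [Nonempty R] [Nonempty C] {q : C → ℝ}
    (hq : IsMinimaxStrategy U q) :
    ∃ v : ℝ, ∃ p ∈ stdSimplex ℝ R, (∀ q' ∈ stdSimplex ℝ C, v ≤ payoff U p q') ∧
      ∀ p' ∈ stdSimplex ℝ R, payoff U p' q ≤ v := by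
  classical
  obtain ⟨q₀, hq₀, p₀, hp₀, hs⟩ := exists_isSaddlePointOn_payoff U
  refine ⟨payoff U p₀ q₀, p₀, hp₀, fun q' hq' => hs q' hq' p₀ hp₀, fun p' hp' => ?_⟩
  have : Nonempty (stdSimplex ℝ R) := ⟨⟨p₀, hp₀⟩⟩
  -- Without boundedness the real supremum would be the default value 0 and bound nothing.
  have hbdd : BddAbove (Set.range fun p : stdSimplex ℝ R => payoff U p q) := by
    have := (isCompact_stdSimplex ℝ R).bddAbove_image (continuous_payoff_left U q).continuousOn
    rwa [Set.image_eq_range] at this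
  calc payoff U p' q ≤ ⨆ p : stdSimplex ℝ R, payoff U p q := le_ciSup hbdd ⟨p', hp'⟩
    _ ≤ ⨆ p : stdSimplex ℝ R, payoff U p q₀ := hq.2 q₀ hq₀
    _ ≤ payoff U p₀ q₀ := ciSup_le fun p => hs q₀ hq₀ p p.2

/-- Complementary slackness: an optimal row strategy is carried by best responses. -/
theorem row_eq_of_optimal {v : ℝ} {p : R → ℝ} {q : C → ℝ} (hp : p ∈ stdSimplex ℝ R)
    (hv : v ≤ payoff U p q) (hr : ∀ r, ∑ c, U r c * q c ≤ v) {r : R} (hpr : p r ≠ 0) :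
    ∑ c, U r c * q c = v := by
  have hsum : ∑ r, p r * (v - ∑ c, U r c * q c) ≤ 0 := by
    simp only [mul_sub, sum_sub_distrib, ← sum_mul, hp.2, one_mul]
    rw [payoff_eq_sum_rows] at hv
    linarith
  have hnn : ∀ r ∈ univ, 0 ≤ p r * (v - ∑ c, U r c * q c) := fun r _ =>
    mul_nonneg (hp.1 r) (sub_nonneg.2 (hr r))
  have h0 := (sum_eq_zero_iff_of_nonneg hnn).1 (le_antisymm hsum (sum_nonneg hnn)) r (mem_univ r)
  have := (mul_eq_zero.1 h0).resolve_left hpr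
  linarith

end Games

/-! ### Allocations -/

section Allocations

variable {N M : ℕ}

theorem mem_elements {h : Allocation N M} {e : Fin N × Fin M} :
    e ∈ elements h ↔ h e.2 = e.1 := by
  simp only [elements, mem_image, mem_univ, true_and]
  constructor
  · rintro ⟨j, rfl⟩
    rfl
  · intro he
    exact ⟨e.2, by rw [he]⟩

theorem elements_injective : Function.Injective (elements (N := N) (M := M)) := by
  intro h h' hh
  ext j
  have : (h j, j) ∈ elements h' := hh ▸ mem_elements.2 rfl
  rw [mem_elements.1 this]

theorem sum_elements (h : Allocation N M) (w : Fin N × Fin M → ℝ) :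
    ∑ e ∈ elements h, w e = ∑ j, w (h j, j) :=
  sum_image fun _ _ _ _ hj => (Prod.ext_iff.1 hj).2

theorem sum_originalGame_mul (a : Fin N → Fin M → Fin M → ℝ) (q : Fin M → ℝ)
    (h : Allocation N M) :
    ∑ k, originalGame a h k * q k = ∑ j, expectedBid a q (h j, j) := by
  simp only [originalGame, Matrix.of_apply, allocVec, expectedBid, sum_mul]
  rw [sum_comm]
  simp only [mul_comm]

/-- `h.setValue j i` is the allocation `h` with channel `j` given to the user `i`, if `i` gets
nothing in `h`. -/
theorem setValue_apply_of_notMem {h : Allocation N M} {i : Fin N} (hi : ∀ j, h j ≠ i)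
    (j j' : Fin M) : h.setValue j i j' = if j' = j then i else h j' := by
  simp only [Function.Embedding.setValue, Function.Embedding.coeFn_mk]
  split_ifs with h1 h2
  · rfl
  · exact absurd h2 (hi j')
  · rfl

theorem sum_setValue {h : Allocation N M} {i : Fin N} (hi : ∀ j, h j ≠ i) (j : Fin M)
    (f : Fin N × Fin M → ℝ) :
    ∑ j', f (h.setValue j i j', j') = ∑ j', f (h j', j') + (f (i, j) - f (h j, j)) := by
  rw [← add_sum_erase univ _ (mem_univ j), ← add_sum_erase univ (fun j' => f (h j', j'))
    (mem_univ j)]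
  have : ∑ j' ∈ univ.erase j, f (h.setValue j i j', j') = ∑ j' ∈ univ.erase j, f (h j', j') :=
    sum_congr rfl fun j' hj' => by
      rw [setValue_apply_of_notMem hi, if_neg (ne_of_mem_erase hj')]
  rw [this, setValue_apply_of_notMem hi, if_pos rfl]
  ring

/-! ### Generic bids exclude complete ties -/

theorem mem_elements_setValue {h : Allocation N M} {i : Fin N} (hi : ∀ j, h j ≠ i)
    (j j' : Fin M) : (i, j) ∈ elements (h.setValue j' i) ↔ j = j' := by
  rw [mem_elements, setValue_apply_of_notMem hi]
  by_cases hj : j = j' <;> simp [hj, hi]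

/-- If the idle user `i` ties with the owner of every channel, then the bids are not generic. -/
theorem exists_affinelyRelated_of_ties {a : Fin N → Fin M → Fin M → ℝ} {q : Fin M → ℝ}
    (hq : q ≠ 0) {h : Allocation N M} {i : Fin N} (hi : ∀ j, h j ≠ i)
    (htie : ∀ j, expectedBid a q (i, j) = expectedBid a q (h j, j)) :
    ∃ (h₀ : Allocation N M) (g : Fin M → Allocation N M),
      HavePrivateElements h₀ g ∧ AffinelyRelated a h₀ g := by
  classical
  set g : Fin M → Allocation N M := fun j => h.setValue j i with hg
  have hmem : ∀ j j', (i, j) ∈ elements (g j') ↔ j = j' := mem_elements_setValue hi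
  have hmem₀ : ∀ j, (i, j) ∉ elements h := fun j hj => hi j (mem_elements.1 hj)
  -- The ties put `q` in the kernel of this square matrix, so its rows are dependent: `c` below lies
  -- in the left kernel.
  let D : Matrix (Fin M) (Fin M) ℝ := Matrix.of fun j k => allocVec a (g j) k - allocVec a h k
  have hD : D.mulVec q = 0 := by
    ext j
    have h1 := sum_originalGame_mul a q (g j)
    have h2 := sum_originalGame_mul a q h
    rw [sum_setValue hi j, htie, sub_self, add_zero, ← h2] at h1
    simp only [originalGame, Matrix.of_apply] at h1
    simp [D, Matrix.mulVec, dotProduct, sub_mul, h1]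
  obtain ⟨c, hc0, hc⟩ := Matrix.exists_vecMul_eq_zero_iff.2
    (Matrix.exists_mulVec_eq_zero_iff.1 ⟨q, hq, hD⟩)
  have hc' : ∑ j, c j • allocVec a (g j) = (∑ j, c j) • allocVec a h := by
    ext k
    have := congrFun hc k
    simp only [D, Matrix.vecMul, dotProduct, Matrix.of_apply, mul_sub, sum_sub_distrib,
      Pi.zero_apply, ← sum_mul] at this
    simp only [Finset.sum_apply, Pi.smul_apply, smul_eq_mul]
    linarith
  by_cases hs : ∑ j, c j = 0
  · obtain ⟨s, hcs⟩ := Function.ne_iff.1 hc0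
    simp only [Pi.zero_apply] at hcs
    -- With a single channel, the zero sum would force `c s = 0`.
    obtain ⟨t, hts⟩ : ∃ t, t ≠ s := by
      by_contra! hall
      refine hcs ?_
      rw [← hs]
      exact (Fintype.sum_eq_single s fun x hx => absurd (hall x) hx).symm
    -- Here `g s` is an affine combination of the other `g j`, which are one short of `M`
    -- allocations. The filler `σ` has weight 0; its private element is `(h s, t)`, since in every
    -- `g j` channel `t` belongs to `i` or to `h t`.
    set σ : Allocation N M := (Equiv.swap s t).toEmbedding.trans h with hσ
    have hσi : ∀ j, (i, j) ∉ elements σ := fun j hj => hi _ (mem_elements.1 hj)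
    have hσg : ∀ j, (h s, t) ∉ elements (g j) := by
      intro j hj
      have := mem_elements.1 hj
      simp only [hg, setValue_apply_of_notMem hi] at this
      split_ifs at this
      · exact hi _ this.symm
      · exact hts (h.injective this)
    refine ⟨g s, Function.update g s σ, fun j => ?_,
      Function.update (fun j => -c j / c s) s 0, ?_, ?_⟩
    · by_cases hj : j = s
      · subst hj
        refine ⟨(h j, t), ?_, hσg _, fun j' hj' => ?_⟩
        · simp [mem_elements, hσ]
        · rw [Function.update_of_ne hj']
          exact hσg _
      · refine ⟨(i, j), ?_, ?_, fun j' hj' => ?_⟩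
        · rw [Function.update_of_ne hj, hmem]
        · rwa [hmem]
        · by_cases hjs : j' = s
          · subst hjs
            rw [Function.update_self]
            exact hσi j
          · rw [Function.update_of_ne hjs, hmem]
            exact hj'.symm
    · have h1 := sum_erase_add univ c (mem_univ s)
      rw [sum_update_of_mem (mem_univ s), ← erase_eq, ← sum_div, sum_neg_distrib, zero_add,
        div_eq_one_iff_eq hcs]
      linarith
    · have h1 := sum_erase_add univ (fun j => c j • allocVec a (g j)) (mem_univ s)
      rw [hc', hs, zero_smul] at h1
      rw [← add_sum_erase univ _ (mem_univ s), Function.update_self, zero_smul, zero_add]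
      have h2 : ∀ j ∈ univ.erase s, Function.update (fun j => -c j / c s) s 0 j •
          allocVec a (Function.update g s σ j) = (-(c s)⁻¹) • c j • allocVec a (g j) := by
        intro j hj
        rw [Function.update_of_ne (ne_of_mem_erase hj), Function.update_of_ne (ne_of_mem_erase hj),
          smul_smul]
        congr 1
        ring
      rw [sum_congr rfl h2, ← smul_sum, eq_neg_of_add_eq_zero_left h1, smul_neg, neg_smul, neg_neg,
        smul_smul, inv_mul_cancel₀ hcs, one_smul]
  · refine ⟨h, g, fun j => ⟨(i, j), (hmem j j).2 rfl, hmem₀ j, fun j' hj' => ?_⟩,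
      fun j => c j / ∑ j, c j, ?_, ?_⟩
    · rw [hmem]
      exact hj'.symm
    · rw [← sum_div, div_self hs]
    · simp only [div_eq_inv_mul, mul_smul, ← smul_sum, hc']
      rw [smul_smul, inv_mul_cancel₀ hs, one_smul]

/-! ### Outcomes of the two-level auction -/

/-- If every channel is the first preference of its owner, and every idle user prefers a channel
on which it is strictly outbid by the owner, then the auction returns the given allocation. -/
theorem IsOutcome.eq_of_outbid {w : Fin N × Fin M → ℝ} {l : Fin N → Fin M}
    {h h' : Allocation N M} (howner : ∀ j, l (h j) = j)
    (hidle : ∀ i, (∀ j, h j ≠ i) → w (i, l i) < w (h (l i), l i))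
    (hout : IsOutcome w l h') : h' = h := by
  obtain ⟨z₁, z₂, ⟨⟨hE, -, hex, -⟩, hmax⟩, ⟨⟨-, hC₂, -⟩, -⟩, hel⟩ := hout
  have hl : univ.image l = univ := eq_univ_of_forall fun j => mem_image.2 ⟨h j, mem_univ _, howner j⟩
  rw [hl] at hex
  have hz₁l : ∀ e ∈ z₁, l e.1 = e.2 := fun e he => by
    obtain ⟨i, -, rfl⟩ := mem_image.1 (hE he)
    rfl
  have hassign : IsAssignment (univ.image fun i => (i, l i)) (univ.image l) (elements h) := by
    refine ⟨fun e he => ?_, fun e _ => by simp [hl], fun j _ => ⟨h j, mem_elements.2 rfl,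
      fun i hi => (mem_elements.1 hi).symm⟩, fun i j j' hj hj' => ?_⟩
    · refine mem_image.2 ⟨e.1, mem_univ _, Prod.ext rfl ?_⟩
      have := mem_elements.1 he
      simp only [← this, howner]
    · exact h.injective ((mem_elements.1 hj).trans (mem_elements.1 hj').symm)
  have hle := hmax _ hassign
  choose u hu huniq using fun j => hex j (mem_univ j)
  have hz₁ : z₁ = univ.image fun j => (u j, j) := by
    ext ⟨i, j⟩
    simp only [mem_image, mem_univ, true_and, Prod.mk.injEq]
    constructor
    · exact fun hij => ⟨j, (huniq j i hij).symm, rfl⟩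
    · rintro ⟨j', rfl, rfl⟩
      exact hu j'
  -- A winner of `j` other than its owner is idle in `h`: the owner of another channel would have
  -- bid for that one.
  have hlt : ∀ j, u j ≠ h j → w (u j, j) < w (h j, j) := by
    intro j hj
    have hlj : l (u j) = j := hz₁l _ (hu j)
    have hown : ∀ j', h j' ≠ u j := fun j' hj' => by
      have hjj : j' = j := by rw [← howner j', hj', hlj]
      exact hj (by rw [← hj', hjj])
    have := hidle (u j) hown
    rwa [hlj] at this
  have hueq : ∀ j, u j = h j := by
    by_contra! hne
    obtain ⟨j, hj⟩ := hne
    have : ∑ e ∈ z₁, w e = ∑ j, w (u j, j) := by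
      rw [hz₁]
      exact sum_image fun _ _ _ _ hj => (Prod.ext_iff.1 hj).2
    rw [this, sum_elements] at hle
    refine absurd hle (not_le.2 (sum_lt_sum (fun j _ => ?_) ⟨j, mem_univ j, hlt j hj⟩))
    by_cases hj : u j = h j
    · rw [hj]
    · exact (hlt j hj).le
  have hz₁' : z₁ = elements h := by
    rw [hz₁]
    simp only [hueq, elements]
  have hz₂ : z₂ = ∅ := by
    refine eq_empty_of_forall_notMem fun e he => mem_compl.1 (hC₂ e he) ?_
    exact mem_image.2 ⟨(u e.2, e.2), hu _, rfl⟩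
  exact elements_injective (by rw [hel, hz₁', hz₂, union_empty])

end Allocations

/-! ### Equality of the values -/

variable {N M : ℕ}

/-- Under generic bids, every allocation that maximizes the expected bids is the only outcome of the
auction for some profile of first preferences. -/
theorem exists_profile_of_maximal {a : Fin N → Fin M → Fin M → ℝ} {q : Fin M → ℝ}
    (hgen : ∀ (h₀ : Allocation N M) (g : Fin M → Allocation N M), HavePrivateElements h₀ g →
      ¬ AffinelyRelated a h₀ g)
    (hq : q ≠ 0) {h : Allocation N M}
    (hmax : ∀ h' : Allocation N M,
      ∑ j, expectedBid a q (h' j, j) ≤ ∑ j, expectedBid a q (h j, j)) :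
    ∃ l : Fin N → Fin M, ∀ h', IsOutcome (expectedBid a q) l h' → h' = h := by
  classical
  have hpref : ∀ i, ∃ j, h j = i ∨
      (∀ j', h j' ≠ i) ∧ expectedBid a q (i, j) < expectedBid a q (h j, j) := by
    intro i
    by_cases hi : ∃ j, h j = i
    · exact hi.imp fun _ => Or.inl
    push Not at hi
    by_contra! hall
    -- Handing `j` to the idle user cannot raise the total, so its bid is at most the owner's;
    -- `hall` gives the reverse.
    obtain ⟨h₀, g, hp, hr⟩ := exists_affinelyRelated_of_ties (a := a) hq hi fun j => by
      have h1 := hmax (h.setValue j i)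
      rw [sum_setValue hi] at h1
      exact le_antisymm (by linarith) ((hall j).2 hi)
    exact hgen h₀ g hp hr
  choose l hl using hpref
  have howner : ∀ j, l (h j) = j := fun j => by
    rcases hl (h j) with hj | hj
    · exact h.injective hj
    · exact absurd rfl (hj.1 j)
  refine ⟨l, fun h' hout => hout.eq_of_outbid howner fun i hi => ?_⟩
  exact ((hl i).resolve_left (hi _)).2

theorem exists_isGameValue_pcGame (hM : 1 ≤ M) (hMN : M ≤ N) {a : Fin N → Fin M → Fin M → ℝ}
    (hgen : ∀ (h₀ : Allocation N M) (g : Fin M → Allocation N M), HavePrivateElements h₀ g →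
      ¬ AffinelyRelated a h₀ g)
    {q : Fin M → ℝ} (hq : IsMinimaxStrategy (originalGame a) q)
    {τ : (Fin N → Fin M) → Allocation N M → ℝ} (hτ : IsTieBreaking (expectedBid a q) τ) :
    ∃ v : ℝ, IsGameValue (originalGame a) v ∧ IsGameValue (pcGame a τ) v := by
  classical
  have : Nonempty (Fin M) := ⟨⟨0, hM⟩⟩
  have : Nonempty (Allocation N M) := ⟨Fin.castLEEmb hMN⟩
  obtain ⟨v, p, hp, hpv, hqv⟩ := hq.exists_optimal_row_strategy
  have hrow : ∀ h, ∑ k, originalGame a h k * q k ≤ v := fun h => by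
    rw [← payoff_single_left]
    exact hqv _ (single_mem_stdSimplex ℝ h)
  have hq0 : q ≠ 0 := by
    rintro rfl
    simpa using hq.1.2
  have hprofile : ∀ h, ∃ l : Fin N → Fin M, p h ≠ 0 →
      ∀ h', IsOutcome (expectedBid a q) l h' → h' = h := by
    intro h
    by_cases hph : p h = 0
    · exact ⟨fun _ => Classical.arbitrary _, fun h' => absurd hph h'⟩
    obtain ⟨l, hl⟩ := exists_profile_of_maximal hgen hq0 (h := h) fun h' => by
      rw [← sum_originalGame_mul, ← sum_originalGame_mul,
        row_eq_of_optimal hp (hpv q hq.1) hrow hph]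
      exact hrow h'
    exact ⟨l, fun _ => hl⟩
  choose L hL using hprofile
  have hpc : ∀ h, p h ≠ 0 → ∀ k, pcGame a τ (L h) k = originalGame a h k := by
    intro h hph k
    have hzero : ∀ h', h' ≠ h → τ (L h) h' = 0 := fun h' hne => by
      by_contra hne'
      exact hne (hL h hph h' ((hτ (L h)).2 h' hne'))
    have hone : τ (L h) h = 1 := by
      rw [← (hτ (L h)).1.2]
      exact (Fintype.sum_eq_single h hzero).symm
    simp only [pcGame, originalGame, Matrix.of_apply]
    rw [Fintype.sum_eq_single h fun h' hne => by rw [hzero h' hne, zero_mul], hone, one_mul]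
  -- Change of variables for the image of `p` under `L`. Fibre sums are needed because `L` is
  -- arbitrary, possibly not injective, off the support of `p`.
  have hpush : ∀ f : (Fin N → Fin M) → ℝ,
      ∑ l, (∑ h with L h = l, p h) * f l = ∑ h, p h * f (L h) := by
    intro f
    rw [← sum_fiberwise univ L]
    refine sum_congr rfl fun l _ => ?_
    rw [sum_mul]
    exact sum_congr rfl fun h hh => by rw [(mem_filter.1 hh).2]
  refine ⟨v, ⟨⟨p, hp, hpv⟩, q, hq.1, hqv⟩,
    ⟨fun l => ∑ h with L h = l, p h, ⟨fun l => sum_nonneg fun h _ => hp.1 h, ?_⟩,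
      fun q' hq' => ?_⟩, q, hq.1, fun p' hp' => ?_⟩
  · simpa [hp.2] using hpush 1
  · refine (hpv q' hq').trans_eq ?_
    rw [payoff_eq_sum_rows, payoff_eq_sum_rows, hpush]
    refine sum_congr rfl fun h _ => ?_
    by_cases hph : p h = 0
    · simp [hph]
    · simp only [hpc h hph]
  -- The tie-breaking distribution `τ l` is itself a mixed strategy of the original game.
  · have hrow' : ∀ l, ∑ k, pcGame a τ l k * q k ≤ v := by
      intro l
      have : ∑ k, pcGame a τ l k * q k = payoff (originalGame a) (τ l) q := by
        rw [payoff_eq_sum_columns]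
        rfl
      rw [this]
      exact hqv _ (hτ l).1
    rw [payoff_eq_sum_rows]
    calc _ ≤ ∑ l, p' l * v := sum_le_sum fun l _ => mul_le_mul_of_nonneg_left (hrow' l) (hp'.1 l)
      _ = v := by rw [← sum_mul, hp'.2, one_mul]

end AntiJamming

theorem proposition2 {Ω : Type*} [MeasurableSpace Ω] (μ : MeasureTheory.Measure Ω)
    [MeasureTheory.IsProbabilityMeasure μ] (N M : ℕ) (hM : 1 ≤ M) (hMN : M ≤ N)
    (a : Ω → Fin N → Fin M → Fin M → ℝ)
    (hgen : ∀ (h₀ : AntiJamming.Allocation N M) (h : Fin M → AntiJamming.Allocation N M),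
      AntiJamming.HavePrivateElements h₀ h → μ {ω | AntiJamming.AffinelyRelated (a ω) h₀ h} = 0) :
    ∀ᵐ ω ∂μ, ∀ q : Fin M → ℝ,
      AntiJamming.IsMinimaxStrategy (AntiJamming.originalGame (a ω)) q →
      ∀ τ : (Fin N → Fin M) → AntiJamming.Allocation N M → ℝ,
        AntiJamming.IsTieBreaking (AntiJamming.expectedBid (a ω) q) τ →
        ∃ v : ℝ, AntiJamming.IsGameValue (AntiJamming.originalGame (a ω)) v ∧
          AntiJamming.IsGameValue (AntiJamming.pcGame (a ω) τ) v := by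
  have hae : ∀ᵐ ω ∂μ, ∀ (h₀ : AntiJamming.Allocation N M)
      (g : Fin M → AntiJamming.Allocation N M), AntiJamming.HavePrivateElements h₀ g →
        ¬ AntiJamming.AffinelyRelated (a ω) h₀ g := by
    -- Only finitely many families of allocations exist, so the null sets have a null union.
    simp only [MeasureTheory.ae_all_iff]
    intro h₀ g hp
    exact MeasureTheory.measure_eq_zero_iff_ae_notMem.1 (hgen h₀ g hp)
  filter_upwards [hae] with ω hω q hq τ hτ
  exact AntiJamming.exists_isGameValue_pcGame hM hMN hω hq hτ
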